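/- A *dicot* $\mathcal G=[V,A,B]$ consists of a finite vertex set $V$, a simple graph $[V,A]$ of *solid* edges and a simple graph $[V,B]$ of *dashed* edges such that $[V,A\cup B]$ is bipartite. It carries positive real weights $a(v,v')=a(v',v)$ on solid edges and $b(v,v')=b(v',v)$ on dashed edges (and $x(v)$ on vertices), and an orientation $\mathcal O$, which gives each solid edge one of its two directions. A *loop* of the monopole-dimer model on $\mathcal G$ is a directed closed walk $\ell=(v_1,\dots,v_{2m})$, $m\ge 1$, with distinct vertices, whose steps $e_j=(v_j,v_{j+1})$ (with $v_{2m+1}=v_1$) are solid or dashed edges, an even number of them dashed; for $m=1$ it is a doubled edge. Its weight is $$w(\ell)=-\prod_{j=1}^{2m}\begin{cases}+a(v_j,v_{j+1}) & \text{if } e_j \text{ is solid and } v_j\to v_{j+1}\text{ in }\mathcal O,\\ -a(v_j,v_{j+1}) & \text{if } e_j\text{ is solid and } v_{j+1}\to v_j\text{ in }\mathcal O,\\ i\,b(v_j,v_{j+1}) & \text{if } e_j\text{ is dashed.}\end{cases}$$ Let $\mathcal G$ be a connected planar dicot: $[V,A\cup B]$ is connected, no two vertices are joined by both a solid and a dashed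 edge, and $[V,A\cup B]$ is drawn in the plane so that every face has an even number of dashed edges. Let $\mathcal O$ be a Kasteleyn orientation: for every bounded face, the number of clockwise-oriented solid edges plus half the number of dashed edges is odd. (Both numbers are counted along the clockwise boundary walk of the face; an edge with the same face on both sides is traversed twice, once in each direction.) Then for every loop $\ell=(v_1,\dots,v_{2m})$, $$w(\ell)=(-1)^{\#\{\text{vertices of } V \text{ enclosed by } \ell\}}\ \prod_{j=1}^{2m}\begin{cases}a(v_j,v_{j+1}) & \text{if } e_j\text{ is solid},\\ b(v_j,v_{j+1}) & \text{if } e_j\text{ is dashed,}\end{cases}$$ where the product is positive, and the enclosed vertices are those not on $\ell$ that are separated from the unbounded face by $\ell$. -/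

import Mathlib

/-! ### Plane graphs -/

/-- A rotation system on a simple graph: at each vertex, the darts (directed edges) leaving that
vertex are arranged in one cyclic order. We read `rot d` as the dart that follows `d`
counterclockwise around the initial vertex of `d`. -/
structure RotationSystem {V : Type*} (H : SimpleGraph V) where
  rot : Equiv.Perm H.Dart
  fst_rot : ∀ d, (rot d).fst = d.fst
  sameCycle_rot : ∀ d d' : H.Dart, d.fst = d'.fst → rot.SameCycle d d'

namespace RotationSystem

variable {V : Type*} {H : SimpleGraph V} (R : RotationSystem H)

/-- Reversal of darts as a permutation. -/
def flip (H : SimpleGraph V) : Equiv.Perm H.Dart :=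
  Function.Involutive.toPerm SimpleGraph.Dart.symm SimpleGraph.Dart.symm_involutive

/-- The permutation that sends a dart to the next one along the boundary walk of the face on its
right: arrive at the terminal vertex, then leave by the dart that comes next counterclockwise after
the dart just used backwards. In a plane drawing each bounded face is thus traversed clockwise. -/
def faceNext : Equiv.Perm H.Dart := (flip H).trans R.rot

/-- The faces: cyclic boundary walks, that is, orbits of `faceNext`. (A connected graph with at
least one edge has exactly one boundary walk for each face.) -/
def Face : Type _ := Quotient (Equiv.Perm.SameCycle.setoid R.faceNext)

/-- The face on the right of a dart. -/
def rightFace (d : H.Dart) : R.Face := Quotient.mk (Equiv.Perm.SameCycle.setoid R.faceNext) d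

end RotationSystem

/-- A plane drawing, up to orientation-preserving homeomorphism of the plane, of a finite connected
graph with at least one edge: a rotation system of genus zero (`#V - #E + #F = 2`, an embedding
in the sphere), together with the face that contains the point at infinity. -/
structure PlaneDrawing {V : Type*} (H : SimpleGraph V) extends RotationSystem H where
  connected : H.Connected
  genus_zero : Nat.card V + Nat.card toRotationSystem.Face = Nat.card H.edgeSet + 2
  outer : toRotationSystem.Face

/-! ### Dicots -/

/-- A dicot: solid and dashed edges on a vertex set, each kind forming a simple graph, and all
edges together forming a bipartite graph. A pair of vertices may be joined both by a solid and by a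
dashed edge. -/
structure Dicot (V : Type*) where
  solid : SimpleGraph V
  dashed : SimpleGraph V
  bipartite : (solid ⊔ dashed).IsBipartite

namespace Dicot

variable {V : Type*}

/-- The underlying graph, with edges of both kinds. -/
abbrev graph (G : Dicot V) : SimpleGraph V := G.solid ⊔ G.dashed

/-- Positive real weights on the vertices, the solid edges and the dashed edges. -/
structure Weights (G : Dicot V) where
  vertex : V → ℝ
  a : V → V → ℝ
  b : V → V → ℝ
  vertex_pos : ∀ v, 0 < vertex v
  a_symm : ∀ u v, a u v = a v u
  b_symm : ∀ u v, b u v = b v u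
  a_pos : ∀ u v, G.solid.Adj u v → 0 < a u v
  b_pos : ∀ u v, G.dashed.Adj u v → 0 < b u v

/-- An orientation: each solid edge gets exactly one of its two directions. -/
structure Orientation (G : Dicot V) where
  dir : V → V → Prop
  adj_of_dir : ∀ u v, dir u v → G.solid.Adj u v
  dir_or_dir : ∀ u v, G.solid.Adj u v → dir u v ∨ dir v u
  not_dir_of_dir : ∀ u v, dir u v → ¬ dir v u

/-- A loop of the monopole-dimer model: a directed closed walk `v_0 → v_1 → ⋯ → v_{2m-1} → v_0`,
`m ≥ 1`, with distinct vertices, each step along a solid or a dashed edge, and with an even number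
of dashed steps. For `m = 1` it is a doubled edge. The indices are cyclic: `finRotate` sends `j` to
`j + 1` and the last index to `0`. -/
structure Loop (G : Dicot V) where
  m : ℕ
  m_pos : 0 < m
  vert : Fin (2 * m) → V
  vert_injective : Function.Injective vert
  dashedSteps : Finset (Fin (2 * m))
  adj_dashed : ∀ j ∈ dashedSteps, G.dashed.Adj (vert j) (vert (finRotate _ j))
  adj_solid : ∀ j ∉ dashedSteps, G.solid.Adj (vert j) (vert (finRotate _ j))
  even_dashed : Even dashedSteps.card

namespace Loop

variable {G : Dicot V} (ℓ : G.Loop)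

/-- The successor of the `j`-th vertex of the loop. -/
def next (j : Fin (2 * ℓ.m)) : V := ℓ.vert (finRotate _ j)

open Classical in
/-- The weight of a loop: minus the product of `a` for solid steps along the orientation, `-a` for
solid steps against it, and `i b` for dashed steps. -/
noncomputable def weight (w : G.Weights) (O : G.Orientation) : ℂ :=
  - ∏ j, if j ∈ ℓ.dashedSteps then Complex.I * (w.b (ℓ.vert j) (ℓ.next j) : ℂ)
      else if O.dir (ℓ.vert j) (ℓ.next j) then (w.a (ℓ.vert j) (ℓ.next j) : ℂ)
      else - (w.a (ℓ.vert j) (ℓ.next j) : ℂ)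

/-- The product of the edge weights along a loop. -/
def edgeProduct (w : G.Weights) : ℝ :=
  ∏ j, if j ∈ ℓ.dashedSteps then w.b (ℓ.vert j) (ℓ.next j) else w.a (ℓ.vert j) (ℓ.next j)

end Loop

variable {G : Dicot V}

/-- The number of dashed edges on the boundary walk of a face. An edge with the face on both of its
sides is traversed twice by the walk, and counts twice. -/
noncomputable def dashedCount (D : PlaneDrawing G.graph) (f : D.Face) : ℕ :=
  {d : G.graph.Dart | D.rightFace d = f ∧ G.dashed.Adj d.fst d.snd}.ncard

/-- The number of solid edges on the boundary walk of a face that the walk (clockwise if the face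
is bounded) traverses in the direction given by the orientation. -/
noncomputable def clockwiseCount (D : PlaneDrawing G.graph) (O : G.Orientation) (f : D.Face) : ℕ :=
  {d : G.graph.Dart | D.rightFace d = f ∧ O.dir d.fst d.snd}.ncard

/-- A drawing makes the dicot a planar dicot: no two vertices are joined by both kinds of edges and
every face has an even number of dashed edges. -/
structure IsPlanarDicot (D : PlaneDrawing G.graph) : Prop where
  simple : Disjoint G.solid G.dashed
  even_dashedCount : ∀ f, Even (dashedCount D f)

/-- A Kasteleyn orientation: for every bounded face, the number of clockwise-oriented solid edges
plus half the (even) number of dashed edges is odd. -/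
def IsKasteleyn (D : PlaneDrawing G.graph) (O : G.Orientation) : Prop :=
  ∀ f, f ≠ D.outer → Odd (clockwiseCount D O f + dashedCount D f / 2)

/-- Two faces share an edge that is not an edge of the loop. -/
def AdjacentOff (D : PlaneDrawing G.graph) (ℓ : G.Loop) (f g : D.Face) : Prop :=
  ∃ d : G.graph.Dart, (∀ j, d.edge ≠ s(ℓ.vert j, ℓ.next j)) ∧
    D.rightFace d = f ∧ D.rightFace d.symm = g

/-- A face lies outside the loop: it is joined to the outer face by a path in the plane that does
not meet the loop, that is, by crossing successively edges not on the loop. -/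
def OutsideLoop (D : PlaneDrawing G.graph) (ℓ : G.Loop) (f : D.Face) : Prop :=
  Relation.ReflTransGen (AdjacentOff D ℓ) D.outer f

/-- The vertices enclosed by the loop: those that are not on the loop and cannot be joined to
infinity without meeting it. -/
def enclosed (D : PlaneDrawing G.graph) (ℓ : G.Loop) : Set V :=
  {v | v ∉ Set.range ℓ.vert ∧ ∀ d : G.graph.Dart, d.fst = v → ¬ OutsideLoop D ℓ (D.rightFace d)}

end Dicot

/-! Each step against the orientation contributes `-1` and each pair of dashed steps contributes `I
^ 2 = -1`. With the leading minus sign, the claim becomes a parity statement (`odd_enclosed_add`):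
enclosed vertices, plus solid steps against the orientation, plus half the dashed steps, is odd.

For a loop of length at least four, the Kasteleyn conditions are summed over the faces inside.
Modulo 2, each solid edge inside is clockwise for exactly one of its two sides, and each dashed edge
inside is counted twice and then halved. Hence the edges inside, the clockwise solid edges of the
loop and half its dashed edges add up to the number of faces inside. Euler's formula for the open
disc, V - E + F = 1, replaces faces minus edges by enclosed vertices (`odd_of_isKasteleyn`).

The Jordan curve theorem and the disc formula come together from genus zero (`jordan_euler`). A
connected open region with some vertex removed satisfies V - E + F ≤ 1, by a rank count over `ZMod
2`. If the loop did not separate, this would contradict V - E + F = 2 for the sphere. Otherwise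
there are exactly two sides, their two inequalities add up to Euler's formula, and both are
equalities. A doubled edge encloses nothing and is treated directly. -/

/-! ### Faces around a vertex of a rotation system. -/

namespace RotationSystem

variable {V : Type*} {H : SimpleGraph V} (R : RotationSystem H)

theorem rightFace_faceNext (d : H.Dart) : R.rightFace (R.faceNext d) = R.rightFace d :=
  Quotient.sound (Equiv.Perm.sameCycle_apply_left.2 (Equiv.Perm.SameCycle.refl _ _))

theorem rightFace_rot (d : H.Dart) : R.rightFace (R.rot d) = R.rightFace d.symm := by
  have h := R.rightFace_faceNext d.symm
  have h' : R.faceNext d.symm = R.rot d := by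
    change R.rot d.symm.symm = _
    rw [SimpleGraph.Dart.symm_symm]
  rw [h'] at h
  exact h

theorem rightFace_surjective : Function.Surjective R.rightFace := Quotient.mk_surjective

instance [Finite V] : Finite H.Dart :=
  Finite.of_injective (fun d : H.Dart => d.toProd) SimpleGraph.Dart.toProd_injective

instance [Finite V] : Finite R.Face := Finite.of_surjective _ R.rightFace_surjective

theorem fst_rot_pow (n : ℕ) (d : H.Dart) : ((R.rot ^ n) d).fst = d.fst := by
  induction n with
  | zero => rfl
  | succ n ih => rw [pow_succ', Equiv.Perm.mul_apply, R.fst_rot, ih]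

/-- A property of faces that does not change across the edges at a vertex holds for all or none of
the faces around the vertex. -/
theorem rightFace_iff_of_fst_eq [Finite V] (P : R.Face → Prop) (v : V)
    (hP : ∀ d : H.Dart, d.fst = v → (P (R.rightFace d) ↔ P (R.rightFace d.symm)))
    {d d' : H.Dart} (hd : d.fst = v) (hd' : d'.fst = v) :
    P (R.rightFace d) ↔ P (R.rightFace d') := by
  obtain ⟨n, -, rfl⟩ := (R.sameCycle_rot d d' (hd.trans hd'.symm)).exists_pow_eq'
  clear hd'
  induction n with
  | zero => rfl
  | succ n ih =>
    rw [ih, pow_succ', Equiv.Perm.mul_apply, rightFace_rot]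
    exact hP _ ((R.fst_rot_pow n d).trans hd)

/-- A property of faces that does not change across edges holds for all or none of the faces. -/
theorem rightFace_iff_of_forall [Finite V] (hH : H.Connected) (P : R.Face → Prop)
    (hP : ∀ d : H.Dart, P (R.rightFace d) ↔ P (R.rightFace d.symm)) (f g : R.Face) :
    P f ↔ P g := by
  obtain ⟨d, rfl⟩ := R.rightFace_surjective f
  obtain ⟨d', rfl⟩ := R.rightFace_surjective g
  have key : ∀ u v : V, H.Walk u v → ∀ d d' : H.Dart, d.fst = u → d'.fst = v →
      (P (R.rightFace d) ↔ P (R.rightFace d')) := by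
    intro u v p
    induction p with
    | nil => exact fun d d' h h' => R.rightFace_iff_of_fst_eq P _ (fun d _ => hP d) h h'
    | cons h p ih =>
      intro d d' hd hd'
      rw [R.rightFace_iff_of_fst_eq P _ (fun d _ => hP d) hd (d' := ⟨(_, _), h⟩) rfl, hP]
      exact ih _ _ rfl hd'
  exact key _ _ (hH.preconnected d.fst d'.fst).some d d' rfl rfl

/-- Let `x` and `y` leave the same vertex. A property of faces that does not change across the
other edges at that vertex holds for the face to the right of the passage that arrives
along `x` reversed and leaves along `y`, at both ends or at neither end of it. -/
theorem rightFace_symm_iff_of_passage [Finite V] (P : R.Face → Prop) (x y : H.Dart)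
    (hxy : x.fst = y.fst)
    (hP : ∀ d : H.Dart, d.fst = x.fst → d ≠ x → d ≠ y →
      (P (R.rightFace d) ↔ P (R.rightFace d.symm))) :
    P (R.rightFace x.symm) ↔ P (R.rightFace y) := by
  classical
  -- The exponent is positive, so `x = y` means a full turn around the vertex; this occurs for
  -- doubled edges.
  have hex : ∃ n, 0 < n ∧ (R.rot ^ n) x = y := by
    obtain ⟨n, h, -, e⟩ := (R.sameCycle_rot x y hxy).exists_pow_eq''
    exact ⟨n, h, e⟩
  -- By minimality, the darts strictly between `x` and `y` in the rotation are neither of the two.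
  have hmin : ∀ i, 0 < i → i < Nat.find hex → (R.rot ^ i) x ≠ x ∧ (R.rot ^ i) x ≠ y := by
    intro i hi hin
    refine ⟨fun h => ?_, fun h => Nat.find_min hex hin ⟨hi, h⟩⟩
    refine Nat.find_min hex (m := Nat.find hex - i) (by omega) ⟨by omega, ?_⟩
    have h2 := (Nat.find_spec hex).2
    rw [← Nat.sub_add_cancel hin.le, pow_add, Equiv.Perm.mul_apply, h] at h2
    exact h2
  have key : ∀ i, i < Nat.find hex →
      (P (R.rightFace ((R.rot ^ (i + 1)) x)) ↔ P (R.rightFace x.symm)) := by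
    intro i
    induction i with
    | zero => intro _; rw [zero_add, pow_one, rightFace_rot]
    | succ i ih =>
      intro hi
      rw [← ih (by omega), pow_succ', Equiv.Perm.mul_apply, rightFace_rot]
      obtain ⟨h1, h2⟩ := hmin (i + 1) (by omega) hi
      exact (hP _ (R.fst_rot_pow _ _) h1 h2).symm
  obtain ⟨h0, h1⟩ := Nat.find_spec hex
  have := key (Nat.find hex - 1) (by omega)
  rw [Nat.sub_add_cancel h0, h1] at this
  exact this.symm

/-! ### Euler inequality for connected regions, by linear algebra over `ZMod 2`. -/

theorem ncard_and_add_ncard_and_not {A : Type*} [Finite A] (p q : A → Prop) :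
    {x | p x ∧ q x}.ncard + {x | p x ∧ ¬ q x}.ncard = {x | p x}.ncard :=
  Set.ncard_inter_add_ncard_sdiff_eq_ncard {x | p x} {x | q x}

/-- Rank-nullity for both maps, together with the inclusion of the range of `α` in the kernel of
`β`. It is applied with faces, edges and vertices of a region as `A`, `B`, `C`. -/
theorem card_add_card_le_of_comp_eq_zero {K A B C : Type*} [Field K] [Fintype A] [Fintype B]
    [Fintype C] (α : (A → K) →ₗ[K] (B → K)) (β : (B → K) →ₗ[K] (C → K)) (h : β ∘ₗ α = 0)
    (hβ : Function.Surjective β) (hα : Module.finrank K (LinearMap.ker α) ≤ 1) :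
    Fintype.card C + Fintype.card A ≤ Fintype.card B + 1 := by
  have h1 := α.finrank_range_add_finrank_ker
  have h2 := β.finrank_range_add_finrank_ker
  have h3 : LinearMap.range α ≤ LinearMap.ker β := LinearMap.range_le_ker_iff.2 h
  have h4 := Submodule.finrank_mono h3
  rw [LinearMap.range_eq_top.2 hβ, finrank_top] at h2
  simp only [Module.finrank_fintype_fun_eq_card] at h1 h2
  omega

/-- An inequality for the Euler characteristic of a connected open region: `U` is the set of its
faces, and `L` and `C` are the edges and vertices that have been removed. -/
theorem two_mul_ncard_add_two_mul_ncard_le [Finite V]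
    (hH : H.Connected) (L : Set (Sym2 V)) (C : Set V) (hC : C.Nonempty)
    (hLC : ∀ d : H.Dart, d.edge ∈ L → d.fst ∈ C) (U : R.Face → Prop)
    (hU : ∀ d : H.Dart, d.edge ∉ L → U (R.rightFace d) → U (R.rightFace d.symm)) (f₀ : R.Face)
    (hf₀ : ∀ f, U f → Relation.ReflTransGen
      (fun f g => ∃ d : H.Dart, d.edge ∉ L ∧ R.rightFace d = f ∧ R.rightFace d.symm = g) f₀ f)
    (hUf₀ : U f₀) :
    2 * {v : V | v ∉ C ∧ ∀ d : H.Dart, d.fst = v → U (R.rightFace d)}.ncard +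
      2 * {f : R.Face | U f}.ncard ≤
    {d : H.Dart | d.edge ∉ L ∧ U (R.rightFace d)}.ncard + 2 := by
  classical
  have := Fintype.ofFinite V
  have := Fintype.ofFinite H.Dart
  have := Fintype.ofFinite R.Face
  set 𝓥 := {v : V // v ∉ C ∧ ∀ d : H.Dart, d.fst = v → U (R.rightFace d)} with h𝓥
  set 𝓕 := {f : R.Face // U f} with h𝓕
  set s := Finset.univ.filter fun d : H.Dart => d.edge ∉ L ∧ U (R.rightFace d) with hs
  set 𝓔 := {e : Sym2 V // e ∈ s.image SimpleGraph.Dart.edge} with h𝓔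
  have mem_s : ∀ d : H.Dart, d ∈ s ↔ d.edge ∉ L ∧ U (R.rightFace d) := fun d => by simp [hs]
  have symm_s : ∀ d ∈ s, d.symm ∈ s := fun d hd => by
    rw [mem_s] at hd ⊢
    rw [SimpleGraph.Dart.edge_symm]
    exact ⟨hd.1, hU d hd.1 hd.2⟩
  have star_s : ∀ v : 𝓥, ∀ d : {d : H.Dart // d.fst = v.1}, d.1 ∈ s := fun v d => by
    rw [mem_s]
    exact ⟨fun h => v.2.1 (d.2 ▸ hLC _ h), v.2.2 _ d.2⟩
  let π : ∀ d ∈ s, 𝓔 := fun d hd => ⟨d.edge, Finset.mem_image_of_mem _ hd⟩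
  have hcard : s.card = 2 * Fintype.card 𝓔 := by
    rw [Fintype.card_coe, mul_comm]
    rw [Finset.card_eq_sum_card_image SimpleGraph.Dart.edge s]
    refine Finset.sum_const_nat fun e he => ?_
    obtain ⟨d, hd, rfl⟩ := Finset.mem_image.1 he
    have : s.filter (fun d' => d'.edge = d.edge) = {d, d.symm} := by
      ext d'
      simp only [Finset.mem_filter, SimpleGraph.dart_edge_eq_iff, Finset.mem_insert,
        Finset.mem_singleton, and_iff_right_iff_imp]
      rintro (rfl | rfl)
      exacts [hd, symm_s _ hd]
    rw [this, Finset.card_pair d.symm_ne.symm]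
  have rep : ∀ e : 𝓔, ∃ d ∈ s, d.edge = e.1 := fun e => Finset.mem_image.1 e.2
  choose r hr hre using rep
  -- The complex of the dual cell structure: `α` adds the values on the two sides of an edge, and
  -- `β` below adds the values on the edges at a vertex.
  let α : (𝓕 → ZMod 2) →ₗ[ZMod 2] (𝓔 → ZMod 2) :=
    { toFun := fun g e => g ⟨R.rightFace (r e), ((mem_s _).1 (hr e)).2⟩ +
        g ⟨R.rightFace (r e).symm, ((mem_s _).1 (symm_s _ (hr e))).2⟩
      map_add' := fun g g' => by ext e; simp only [Pi.add_apply]; ring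
      map_smul' := fun c g => by ext e; simp [mul_add] }
  have hα : ∀ g d (hd : d ∈ s), α g (π d hd) = g ⟨R.rightFace d, ((mem_s _).1 hd).2⟩ +
        g ⟨R.rightFace d.symm, ((mem_s _).1 (symm_s _ hd)).2⟩ := by
    intro g d hd
    change g _ + g _ = _
    rcases (SimpleGraph.dart_edge_eq_iff _ _).1 (hre (π d hd)) with h | h
    · simp only [h]
    · simp only [h, SimpleGraph.Dart.symm_symm]
      exact add_comm _ _
  let β : (𝓔 → ZMod 2) →ₗ[ZMod 2] (𝓥 → ZMod 2) :=
    { toFun := fun c v => ∑ d : {d : H.Dart // d.fst = v.1}, c (π d.1 (star_s v d))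
      map_add' := fun g g' => by ext v; simp [Finset.sum_add_distrib]
      map_smul' := fun c g => by ext v; simp [Finset.mul_sum] }
  have hβα : β ∘ₗ α = 0 := by
    refine LinearMap.ext fun g => funext fun v => ?_
    let σ : Equiv.Perm {d : H.Dart // d.fst = v.1} :=
      R.rot.subtypePerm fun d => by rw [R.fst_rot]
    change ∑ d : {d : H.Dart // d.fst = v.1}, α g (π d.1 (star_s v d)) = 0
    simp only [hα, Finset.sum_add_distrib]
    -- The left face of a dart is the right face of the next one in the rotation, so around `v` both
    -- sums run over the same values and cancel modulo 2.
    have h1 := Equiv.sum_comp σ fun d => g ⟨R.rightFace d.1, ((mem_s d.1).1 (star_s v d)).2⟩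
    have h2 : ∀ d, g ⟨R.rightFace (σ d).1, ((mem_s (σ d).1).1 (star_s v (σ d))).2⟩ =
        g ⟨R.rightFace d.1.symm, ((mem_s d.1.symm).1 (symm_s d.1 (star_s v d))).2⟩ := fun d =>
      congrArg g (Subtype.ext (R.rightFace_rot d.1))
    rw [← h1]
    simp only [h2]
    exact CharTwo.add_self_eq_zero _
  have hker : Module.finrank (ZMod 2) (LinearMap.ker α) ≤ 1 := by
    have hone : (fun _ => 1 : 𝓕 → ZMod 2) ∈ LinearMap.ker α :=
      LinearMap.mem_ker.2 (funext fun e => CharTwo.add_self_eq_zero _)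
    refine finrank_le_one ⟨_, hone⟩ fun g => ⟨g.1 ⟨f₀, hUf₀⟩, ?_⟩
    refine Subtype.ext (funext fun f => ?_)
    obtain ⟨f, hf⟩ := f
    -- An element of the kernel agrees on both sides of every edge, hence is constant on the
    -- connected region.
    have key : ∀ f, Relation.ReflTransGen (fun f g => ∃ d : H.Dart, d.edge ∉ L ∧
        R.rightFace d = f ∧ R.rightFace d.symm = g) f₀ f →
        ∃ h : U f, g.1 ⟨f₀, hUf₀⟩ = g.1 ⟨f, h⟩ := by
      intro f hf
      induction hf with
      | refl => exact ⟨hUf₀, rfl⟩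
      | tail _ h ih =>
        obtain ⟨d, hd, rfl, rfl⟩ := h
        obtain ⟨h1, h2⟩ := ih
        have hds := (mem_s d).2 ⟨hd, h1⟩
        refine ⟨hU d hd h1, h2.trans ?_⟩
        have h3 := congrFun (LinearMap.mem_ker.1 g.2) (π d hds)
        rw [hα _ _ hds] at h3
        exact CharTwo.add_eq_zero.1 h3
    obtain ⟨_, h⟩ := key f (hf₀ f hf)
    simpa using h
  have hβ : Function.Surjective β := by
    -- Indicators of vertices, zero outside `𝓥`. An edge of the region maps to the sum of the
    -- indicators of its ends, so a walk from a removed vertex, where the indicator is zero, puts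
    -- every indicator in the range of `β`.
    let δ : V → 𝓥 → ZMod 2 := fun u v => if v.1 = u then 1 else 0
    have hβδ : ∀ d (hd : d ∈ s), β (Pi.single (π d hd) 1) = δ d.fst + δ d.snd := by
      intro d hd
      funext v
      change ∑ d' : {d : H.Dart // d.fst = v.1},
        (Pi.single (π d hd) 1 : 𝓔 → ZMod 2) (π d'.1 (star_s v d')) = _
      have h1 : ∀ d' : {d : H.Dart // d.fst = v.1},
          (Pi.single (π d hd) 1 : 𝓔 → ZMod 2) (π d'.1 (star_s v d')) =
            if d'.1 = d ∨ d'.1 = d.symm then 1 else 0 := fun d' => by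
        rw [Pi.single_apply]
        exact if_congr (Subtype.ext_iff.trans (SimpleGraph.dart_edge_eq_iff _ _)) rfl rfl
      have hne : d.fst ≠ d.snd := d.fst_ne_snd
      simp only [h1, Pi.add_apply, δ]
      by_cases hv : v.1 = d.fst
      · rw [if_pos hv, if_neg (hv ▸ hne), Finset.sum_eq_single ⟨d, hv.symm⟩]
        · simp
        · intro d' _ hd'
          refine if_neg ?_
          rintro (h | h)
          · exact hd' (Subtype.ext h)
          · exact hne (by rw [← hv, ← d'.2, h]; rfl)
        · exact fun h => absurd (Finset.mem_univ _) h
      · by_cases hw : v.1 = d.snd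
        · rw [if_neg hv, if_pos hw, Finset.sum_eq_single ⟨d.symm, hw.symm⟩]
          · simp
          · intro d' _ hd'
            refine if_neg ?_
            rintro (h | h)
            · exact hne (by rw [← hw, ← d'.2, h])
            · exact hd' (Subtype.ext h)
          · exact fun h => absurd (Finset.mem_univ _) h
        · rw [if_neg hv, if_neg hw, add_zero]
          refine Finset.sum_eq_zero fun d' _ => if_neg ?_
          rintro (h | h)
          · exact hv (by rw [← d'.2, h])
          · exact hw (by rw [← d'.2, h]; rfl)
    have hδ0 : ∀ u, (¬ (u ∉ C ∧ ∀ d : H.Dart, d.fst = u → U (R.rightFace d))) → δ u = 0 :=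
      fun u hu => funext fun v => if_neg fun h : v.1 = u => hu (h ▸ v.2)
    have hstep : ∀ u w, H.Adj u w → δ u ∈ LinearMap.range β → δ w ∈ LinearMap.range β := by
      intro u w huw hu
      let d : H.Dart := ⟨(u, w), huw⟩
      by_cases hd : d ∈ s
      · have h := hβδ d hd
        have h' : δ w = β (Pi.single (π d hd) 1) - δ u := by
          rw [h]; exact (add_sub_cancel_left _ _).symm
        rw [h']
        exact Submodule.sub_mem _ (LinearMap.mem_range_self _ _) hu
      -- All darts at a vertex of `𝓥` lie in `s`, so a step outside `s` ends outside `𝓥`.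
      · rw [hδ0 w]
        · exact Submodule.zero_mem _
        · intro hw
          have h := symm_s _ (star_s ⟨w, hw⟩ ⟨d.symm, rfl⟩)
          rw [SimpleGraph.Dart.symm_symm] at h
          exact hd h
    have hwalk : ∀ u w, H.Walk u w → δ u ∈ LinearMap.range β → δ w ∈ LinearMap.range β := by
      intro u w p
      induction p with
      | nil => exact id
      | cons h p ih => exact fun hu => ih (hstep _ _ h hu)
    obtain ⟨c, hc⟩ := hC
    have hall : ∀ v, δ v ∈ LinearMap.range β := fun v =>
      hwalk c v (hH.preconnected c v).some
        (by rw [hδ0 c fun h => h.1 hc]; exact Submodule.zero_mem _)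
    intro p
    have hp : p = ∑ v : 𝓥, p v • δ v.1 := by
      funext w
      simp only [δ, Finset.sum_apply, Pi.smul_apply, smul_eq_mul, mul_ite, mul_one, mul_zero]
      rw [Finset.sum_eq_single w]
      · rw [if_pos rfl]
      · exact fun v _ hv => if_neg fun h => hv (Subtype.ext h.symm)
      · exact fun h => absurd (Finset.mem_univ _) h
    rw [← LinearMap.mem_range, hp]
    exact Submodule.sum_mem _ fun v _ => Submodule.smul_mem _ _ (hall _)
  have := card_add_card_le_of_comp_eq_zero α β hβα hβ hker
  have h1 : Nat.card 𝓥 =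
      {v : V | v ∉ C ∧ ∀ d : H.Dart, d.fst = v → U (R.rightFace d)}.ncard :=
    Nat.card_coe_set_eq _
  have h2 : Nat.card 𝓕 = {f : R.Face | U f}.ncard := Nat.card_coe_set_eq _
  have h3 : {d : H.Dart | d.edge ∉ L ∧ U (R.rightFace d)} = s := by ext d; simp [hs]
  rw [h3, Set.ncard_coe_finset]
  rw [Nat.card_eq_fintype_card] at h1 h2
  omega

end RotationSystem

/-! ### The two sides of a loop. -/

namespace Dicot

variable {V : Type*} {G : Dicot V}

namespace Loop

variable (ℓ : G.Loop)

/-- The darts traversed by a loop. -/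
def dart (j : Fin (2 * ℓ.m)) : G.graph.Dart :=
  ⟨(ℓ.vert j, ℓ.next j), by
    by_cases h : j ∈ ℓ.dashedSteps
    · exact Or.inr (ℓ.adj_dashed j h)
    · exact Or.inl (ℓ.adj_solid j h)⟩

/-- The edges of a loop. -/
def edges : Set (Sym2 V) := Set.range fun j => (ℓ.dart j).edge

theorem dart_injective : Function.Injective ℓ.dart := fun _ _ h =>
  ℓ.vert_injective (congrArg (fun d : G.graph.Dart => d.fst) h)

theorem symm_dart_injective : Function.Injective fun j => (ℓ.dart j).symm := fun _ _ h =>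
  ℓ.dart_injective (SimpleGraph.Dart.symm_involutive.injective h)

theorem edge_mem_edges_iff (d : G.graph.Dart) :
    d.edge ∈ ℓ.edges ↔ ∃ j, d = ℓ.dart j ∨ d = (ℓ.dart j).symm := by
  simp only [edges, Set.mem_range]
  exact exists_congr fun j => eq_comm.trans (SimpleGraph.dart_edge_eq_iff _ _)

theorem edge_dart_mem (j : Fin (2 * ℓ.m)) : (ℓ.dart j).edge ∈ ℓ.edges := ⟨j, rfl⟩

theorem fst_mem_range_of_edge_mem {d : G.graph.Dart} (h : d.edge ∈ ℓ.edges) :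
    d.fst ∈ Set.range ℓ.vert := by
  obtain ⟨j, rfl | rfl⟩ := (ℓ.edge_mem_edges_iff d).1 h
  exacts [⟨_, rfl⟩, ⟨_, rfl⟩]

theorem adjacentOff_iff (D : PlaneDrawing G.graph) (f g : D.Face) :
    AdjacentOff D ℓ f g ↔
      ∃ d : G.graph.Dart, d.edge ∉ ℓ.edges ∧ D.rightFace d = f ∧ D.rightFace d.symm = g := by
  refine exists_congr fun d => and_congr_left fun _ => ?_
  simp only [edges, Set.mem_range, not_exists]
  exact forall_congr' fun j => ne_comm

theorem forall_iff_of_finRotate {n : ℕ} (Q : Fin n → Prop)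
    (hQ : ∀ j, Q j ↔ Q (finRotate _ j)) (i j : Fin n) : Q i ↔ Q j := by
  obtain _ | n := n
  · exact i.elim0
  have key : ∀ k (h : k < n + 1), Q ⟨k, h⟩ ↔ Q 0 := by
    intro k
    induction k with
    | zero => exact fun _ => Iff.rfl
    | succ k ih =>
      intro h
      rw [← ih (by omega), hQ ⟨k, _⟩, finRotate_of_lt (by omega)]
  exact (key i i.2).trans (key j j.2).symm

theorem not_mem_edges_of_ne {j : Fin (2 * ℓ.m)} {d : G.graph.Dart}
    (hd : d.fst = ℓ.vert (finRotate _ j)) (h1 : d ≠ (ℓ.dart j).symm)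
    (h2 : d ≠ ℓ.dart (finRotate _ j)) : d.edge ∉ ℓ.edges := by
  intro h
  obtain ⟨i, rfl | rfl⟩ := (ℓ.edge_mem_edges_iff d).1 h
  · exact h2 (congrArg ℓ.dart (ℓ.vert_injective hd))
  · exact h1 (congrArg (fun i => (ℓ.dart i).symm)
      ((finRotate _).injective (ℓ.vert_injective hd)))

/-- All faces immediately to the right of a loop lie on the same side of it. -/
theorem rightFace_dart_iff [Finite V] (D : PlaneDrawing G.graph) (T : D.Face → Prop)
    (hT : ∀ d : G.graph.Dart, d.edge ∉ ℓ.edges → (T (D.rightFace d) ↔ T (D.rightFace d.symm)))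
    (i j : Fin (2 * ℓ.m)) :
    T (D.rightFace (ℓ.dart i)) ↔ T (D.rightFace (ℓ.dart j)) := by
  refine forall_iff_of_finRotate (fun j => T (D.rightFace (ℓ.dart j))) (fun j => ?_) i j
  exact D.rightFace_symm_iff_of_passage T (ℓ.dart j).symm (ℓ.dart (finRotate _ j)) rfl
    fun d hd h1 h2 => hT d (ℓ.not_mem_edges_of_ne hd h1 h2)

/-- All faces immediately to the left of a loop lie on the same side of it. -/
theorem rightFace_symm_dart_iff [Finite V] (D : PlaneDrawing G.graph) (T : D.Face → Prop)
    (hT : ∀ d : G.graph.Dart, d.edge ∉ ℓ.edges → (T (D.rightFace d) ↔ T (D.rightFace d.symm)))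
    (i j : Fin (2 * ℓ.m)) :
    T (D.rightFace (ℓ.dart i).symm) ↔ T (D.rightFace (ℓ.dart j).symm) := by
  refine forall_iff_of_finRotate (fun j => T (D.rightFace (ℓ.dart j).symm)) (fun j => ?_) i j
  exact (D.rightFace_symm_iff_of_passage T (ℓ.dart (finRotate _ j)) (ℓ.dart j).symm rfl
    fun d hd h1 h2 => hT d (ℓ.not_mem_edges_of_ne hd h2 h1)).symm

theorem adjacentOff_symm {D : PlaneDrawing G.graph} {f g : D.Face}
    (h : AdjacentOff D ℓ f g) : AdjacentOff D ℓ g f := by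
  rw [adjacentOff_iff] at h ⊢
  obtain ⟨d, hd, rfl, rfl⟩ := h
  exact ⟨d.symm, by rwa [SimpleGraph.Dart.edge_symm], rfl, by rw [SimpleGraph.Dart.symm_symm]⟩

theorem reflTransGen_iff_of_edge_not_mem {D : PlaneDrawing G.graph} (f : D.Face)
    {d : G.graph.Dart} (hd : d.edge ∉ ℓ.edges) :
    Relation.ReflTransGen (AdjacentOff D ℓ) f (D.rightFace d) ↔
      Relation.ReflTransGen (AdjacentOff D ℓ) f (D.rightFace d.symm) := by
  have h : AdjacentOff D ℓ (D.rightFace d) (D.rightFace d.symm) :=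
    (ℓ.adjacentOff_iff D _ _).2 ⟨d, hd, rfl, rfl⟩
  exact ⟨fun h' => h'.tail h, fun h' => h'.tail (ℓ.adjacentOff_symm h)⟩

theorem iff_of_reflTransGen {D : PlaneDrawing G.graph} {T : D.Face → Prop}
    (hT : ∀ d : G.graph.Dart, d.edge ∉ ℓ.edges → (T (D.rightFace d) ↔ T (D.rightFace d.symm)))
    {f g : D.Face} (h : Relation.ReflTransGen (AdjacentOff D ℓ) f g) : T f ↔ T g := by
  induction h with
  | refl => rfl
  | tail _ h ih =>
    obtain ⟨d, hd, rfl, rfl⟩ := (ℓ.adjacentOff_iff D _ _).1 h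
    exact ih.trans (hT d hd)

/-- A loop has at most two sides. -/
theorem reflTransGen_right_or_left [Finite V] (D : PlaneDrawing G.graph) (j : Fin (2 * ℓ.m))
    (f : D.Face) :
    Relation.ReflTransGen (AdjacentOff D ℓ) (D.rightFace (ℓ.dart j)) f ∨
      Relation.ReflTransGen (AdjacentOff D ℓ) (D.rightFace (ℓ.dart j).symm) f := by
  refine (D.rightFace_iff_of_forall D.connected (fun f =>
    Relation.ReflTransGen (AdjacentOff D ℓ) (D.rightFace (ℓ.dart j)) f ∨
      Relation.ReflTransGen (AdjacentOff D ℓ) (D.rightFace (ℓ.dart j).symm) f)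
    (fun d => ?_) f (D.rightFace (ℓ.dart j))).2 (Or.inl .refl)
  by_cases hd : d.edge ∈ ℓ.edges
  · have hr : ∀ i, Relation.ReflTransGen (AdjacentOff D ℓ) (D.rightFace (ℓ.dart j))
        (D.rightFace (ℓ.dart i)) := fun i =>
      (ℓ.rightFace_dart_iff D _ (fun _ => ℓ.reflTransGen_iff_of_edge_not_mem _) i j).2 .refl
    have hl : ∀ i, Relation.ReflTransGen (AdjacentOff D ℓ) (D.rightFace (ℓ.dart j).symm)
        (D.rightFace (ℓ.dart i).symm) := fun i =>
      (ℓ.rightFace_symm_dart_iff D _ (fun _ => ℓ.reflTransGen_iff_of_edge_not_mem _) i j).2 .refl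
    obtain ⟨i, rfl | rfl⟩ := (ℓ.edge_mem_edges_iff d).1 hd
    · exact iff_of_true (Or.inl (hr i)) (Or.inr (hl i))
    · rw [SimpleGraph.Dart.symm_symm]
      exact iff_of_true (Or.inr (hl i)) (Or.inl (hr i))
  · exact or_congr (ℓ.reflTransGen_iff_of_edge_not_mem _ hd)
      (ℓ.reflTransGen_iff_of_edge_not_mem _ hd)

/-- Excludes isolated vertices, for which a condition on all faces around the vertex would be
vacuous. -/
theorem exists_dart_fst_eq {G : Dicot V} (ℓ : G.Loop) (D : PlaneDrawing G.graph) (v : V) :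
    ∃ d : G.graph.Dart, d.fst = v := by
  obtain ⟨p⟩ := D.connected.preconnected v (ℓ.vert ⟨0, by have := ℓ.m_pos; omega⟩)
  cases p with
  | nil => exact ⟨ℓ.dart _, rfl⟩
  | cons h _ => exact ⟨⟨(_, _), h⟩, rfl⟩

/-- A loop that uses an edge in both directions returns after two steps, so `2 * ℓ.m` divides 2. -/
theorem dart_ne_symm_dart (hm : ℓ.m ≠ 1) (i j : Fin (2 * ℓ.m)) : ℓ.dart i ≠ (ℓ.dart j).symm := by
  intro h
  have h1 : i = finRotate _ j :=
    ℓ.vert_injective (congrArg (fun d : G.graph.Dart => d.fst) h)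
  have h2 : finRotate _ i = j :=
    ℓ.vert_injective (congrArg (fun d : G.graph.Dart => d.snd) h)
  rw [h1] at h2
  have hm' := ℓ.m_pos
  clear h h1
  generalize hn : 2 * ℓ.m = n at j h2
  obtain ⟨n, rfl⟩ : ∃ k, n = k + 1 := ⟨n - 1, by omega⟩
  rw [finRotate_apply, finRotate_apply, add_assoc] at h2
  have h3 : (1 + 1 : Fin (n + 1)) = 0 := add_eq_left.1 h2
  have h4 := congrArg Fin.val h3
  rw [Fin.val_add, Fin.val_one', Fin.val_zero, Nat.mod_eq_of_lt (a := 1) (by omega),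
    Nat.mod_eq_of_lt (by omega)] at h4
  omega

/-! ### Jordan curve theorem and Euler formula for a loop. -/

theorem two_mul_ncard_add_two_mul_ncard_le [Finite V] (D : PlaneDrawing G.graph)
    (U : D.Face → Prop)
    (hU : ∀ d : G.graph.Dart, d.edge ∉ ℓ.edges → (U (D.rightFace d) ↔ U (D.rightFace d.symm)))
    (f₀ : D.Face) (hUf₀ : U f₀)
    (hf₀ : ∀ f, U f → Relation.ReflTransGen (AdjacentOff D ℓ) f₀ f) :
    2 * {v : V | v ∉ Set.range ℓ.vert ∧
        ∀ d : G.graph.Dart, d.fst = v → U (D.rightFace d)}.ncard +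
      2 * {f : D.Face | U f}.ncard ≤
    {d : G.graph.Dart | d.edge ∉ ℓ.edges ∧ U (D.rightFace d)}.ncard + 2 := by
  refine D.toRotationSystem.two_mul_ncard_add_two_mul_ncard_le D.connected ℓ.edges
    (Set.range ℓ.vert) ⟨_, ⟨0, by have := ℓ.m_pos; omega⟩, rfl⟩
    (fun _ => ℓ.fst_mem_range_of_edge_mem) U (fun d hd => (hU d hd).1) f₀ (fun f hf => ?_) hUf₀
  exact Relation.ReflTransGen.mono (fun f g => (ℓ.adjacentOff_iff D f g).1) _ _ (hf₀ f hf)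

theorem ncard_range_vert : (Set.range ℓ.vert).ncard = 2 * ℓ.m := by
  rw [← Nat.card_coe_set_eq, Nat.card_range_of_injective ℓ.vert_injective, Nat.card_fin]

/-- No edge at a vertex off the loop belongs to the loop, so the faces around it are all on one
side: "not all in `T`" and "none in `T`" coincide. -/
theorem ncard_vertices [Finite V] (D : PlaneDrawing G.graph) (T : D.Face → Prop)
    (hT : ∀ d : G.graph.Dart, d.edge ∉ ℓ.edges → (T (D.rightFace d) ↔ T (D.rightFace d.symm))) :
    {v : V | v ∉ Set.range ℓ.vert ∧
        ∀ d : G.graph.Dart, d.fst = v → T (D.rightFace d)}.ncard +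
      {v : V | v ∉ Set.range ℓ.vert ∧
        ∀ d : G.graph.Dart, d.fst = v → ¬ T (D.rightFace d)}.ncard +
      2 * ℓ.m = Nat.card V := by
  have h : {v : V | v ∉ Set.range ℓ.vert ∧
        ∀ d : G.graph.Dart, d.fst = v → ¬ T (D.rightFace d)} =
      {v : V | v ∉ Set.range ℓ.vert ∧
        ¬ ∀ d : G.graph.Dart, d.fst = v → T (D.rightFace d)} := by
    ext v
    refine and_congr_right fun hv => ?_
    obtain ⟨d₀, hd₀⟩ := ℓ.exists_dart_fst_eq D v
    have h : ∀ d : G.graph.Dart, d.fst = v → (T (D.rightFace d₀) ↔ T (D.rightFace d)) :=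
      fun d hd => D.rightFace_iff_of_fst_eq T v
        (fun d hd => hT d fun h => hv (hd ▸ ℓ.fst_mem_range_of_edge_mem h)) hd₀ hd
    exact ⟨fun h1 h2 => h1 d₀ hd₀ (h2 d₀ hd₀),
      fun h1 d hd h2 => h1 fun d' hd' => (h d' hd').1 ((h d hd).2 h2)⟩
  rw [h, RotationSystem.ncard_and_add_ncard_and_not]
  have hC := Set.ncard_add_ncard_compl (Set.range ℓ.vert)
  rw [ncard_range_vert, add_comm] at hC
  exact hC

theorem ncard_edge_mem_edges (hm : ℓ.m ≠ 1) :
    {d : G.graph.Dart | d.edge ∈ ℓ.edges}.ncard = 4 * ℓ.m := by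
  have h : {d : G.graph.Dart | d.edge ∈ ℓ.edges} =
      Set.range ℓ.dart ∪ Set.range fun j => (ℓ.dart j).symm := by
    ext d
    rw [Set.mem_ofPred_eq, edge_mem_edges_iff, exists_or]
    simp [eq_comm]
  rw [h, Set.ncard_union_eq _ (Set.finite_range _) (Set.finite_range _),
    ← Nat.card_coe_set_eq, ← Nat.card_coe_set_eq, Nat.card_range_of_injective ℓ.dart_injective,
    Nat.card_range_of_injective ℓ.symm_dart_injective, Nat.card_fin]
  · omega
  · refine Set.disjoint_left.2 ?_
    rintro d ⟨i, rfl⟩ ⟨j, h⟩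
    exact ℓ.dart_ne_symm_dart hm i j h.symm

theorem ncard_darts [Finite V] (D : PlaneDrawing G.graph) (hm : ℓ.m ≠ 1) (T : D.Face → Prop) :
    {d : G.graph.Dart | d.edge ∉ ℓ.edges ∧ T (D.rightFace d)}.ncard +
      {d : G.graph.Dart | d.edge ∉ ℓ.edges ∧ ¬ T (D.rightFace d)}.ncard +
      4 * ℓ.m = Nat.card G.graph.Dart := by
  rw [RotationSystem.ncard_and_add_ncard_and_not, ← ℓ.ncard_edge_mem_edges hm, add_comm]
  exact Set.ncard_add_ncard_compl _

theorem _root_.PlaneDrawing.two_mul_card [Finite V] (D : PlaneDrawing G.graph) :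
    2 * Nat.card V + 2 * Nat.card D.Face = Nat.card G.graph.Dart + 4 := by
  classical
  have := Fintype.ofFinite V
  have h1 := D.genus_zero
  have h2 := SimpleGraph.dart_card_eq_twice_card_edges (G := G.graph)
  rw [← Set.ncard_coe_finset, SimpleGraph.coe_edgeFinset, ← Nat.card_coe_set_eq] at h2
  rw [Nat.card_eq_fintype_card (α := G.graph.Dart)]
  omega

/-- Jordan curve theorem and Euler formula for the inside of a loop of length at least four. -/
theorem jordan_euler [Finite V] (D : PlaneDrawing G.graph) (hm : ℓ.m ≠ 1) :
    ((∀ j, ¬ OutsideLoop D ℓ (D.rightFace (ℓ.dart j)) ∧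
        OutsideLoop D ℓ (D.rightFace (ℓ.dart j).symm)) ∨
      (∀ j, OutsideLoop D ℓ (D.rightFace (ℓ.dart j)) ∧
        ¬ OutsideLoop D ℓ (D.rightFace (ℓ.dart j).symm))) ∧
    2 * {v : V | v ∉ Set.range ℓ.vert ∧
        ∀ d : G.graph.Dart, d.fst = v → ¬ OutsideLoop D ℓ (D.rightFace d)}.ncard +
      2 * {f : D.Face | ¬ OutsideLoop D ℓ f}.ncard =
    {d : G.graph.Dart | d.edge ∉ ℓ.edges ∧ ¬ OutsideLoop D ℓ (D.rightFace d)}.ncard + 2 := by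
  set T := OutsideLoop D ℓ with hTdef
  have hT : ∀ d : G.graph.Dart, d.edge ∉ ℓ.edges →
      (T (D.rightFace d) ↔ T (D.rightFace d.symm)) :=
    fun d hd => ℓ.reflTransGen_iff_of_edge_not_mem D.outer hd
  have hTouter : T D.outer := .refl
  have hF : {f | T f}.ncard + {f | ¬ T f}.ncard = Nat.card D.Face :=
    Set.ncard_add_ncard_compl _
  have hV := ℓ.ncard_vertices D T hT
  have hE := ℓ.ncard_darts D hm T
  have hG := PlaneDrawing.two_mul_card D
  have hle := ℓ.two_mul_ncard_add_two_mul_ncard_le D T hT D.outer hTouter fun f hf => hf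
  have hm' := ℓ.m_pos
  let j₀ : Fin (2 * ℓ.m) := ⟨0, by omega⟩
  -- Removing the loop removes equally many vertices and edges; with no inside, `hle` would bound
  -- the Euler characteristic of the sphere by 1.
  have hall : ¬ ∀ f, T f := by
    intro h
    have h1 : {f : D.Face | ¬ T f}.ncard = 0 := by
      simp [h]
    have h2 : {d : G.graph.Dart | d.edge ∉ ℓ.edges ∧ ¬ T (D.rightFace d)}.ncard = 0 := by
      simp [h]
    have h3 : {v : V | v ∉ Set.range ℓ.vert ∧
        ∀ d : G.graph.Dart, d.fst = v → ¬ T (D.rightFace d)}.ncard = 0 := by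
      rw [Set.ncard_eq_zero, Set.eq_empty_iff_forall_notMem]
      rintro v ⟨-, hv⟩
      obtain ⟨d, hd⟩ := ℓ.exists_dart_fst_eq D v
      exact hv d hd (h _)
    omega
  -- The inequalities for the two sides add up to Euler's formula for the sphere, so neither is
  -- strict.
  have key : ∀ f₀, ¬ T f₀ → (∀ f, ¬ T f → Relation.ReflTransGen (AdjacentOff D ℓ) f₀ f) →
      2 * {v : V | v ∉ Set.range ℓ.vert ∧
        ∀ d : G.graph.Dart, d.fst = v → ¬ T (D.rightFace d)}.ncard +
      2 * {f : D.Face | ¬ T f}.ncard =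
      {d : G.graph.Dart | d.edge ∉ ℓ.edges ∧ ¬ T (D.rightFace d)}.ncard + 2 := by
    intro f₀ h h'
    have := ℓ.two_mul_ncard_add_two_mul_ncard_le D (fun f => ¬ T f)
      (fun d hd => not_congr (hT d hd)) f₀ h h'
    omega
  have hsides := ℓ.reflTransGen_right_or_left D j₀
  have hr := ℓ.rightFace_dart_iff D T hT j₀
  have hl := ℓ.rightFace_symm_dart_iff D T hT j₀
  by_cases h1 : T (D.rightFace (ℓ.dart j₀)) <;> by_cases h2 : T (D.rightFace (ℓ.dart j₀).symm)
  · exact absurd (fun f => (hsides f).elim (fun h => (ℓ.iff_of_reflTransGen hT h).1 h1)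
      fun h => (ℓ.iff_of_reflTransGen hT h).1 h2) hall
  · refine ⟨Or.inr fun j => ⟨(hr j).1 h1, fun h => h2 ((hl j).2 h)⟩, key _ h2 fun f hf => ?_⟩
    exact (hsides f).resolve_left fun h => hf ((ℓ.iff_of_reflTransGen hT h).1 h1)
  · refine ⟨Or.inl fun j => ⟨fun h => h1 ((hr j).2 h), (hl j).1 h2⟩, key _ h1 fun f hf => ?_⟩
    exact (hsides f).resolve_right fun h => hf ((ℓ.iff_of_reflTransGen hT h).1 h2)
  · rcases hsides D.outer with h | h
    · exact absurd ((ℓ.iff_of_reflTransGen hT h).2 hTouter) h1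
    · exact absurd ((ℓ.iff_of_reflTransGen hT h).2 hTouter) h2

end Loop

end Dicot

/-! ### Parity from the Kasteleyn condition. -/

namespace Dicot

variable {V : Type*} {G : Dicot V}

theorem sum_ncard_fiber {A F : Type*} [Finite A] (φ : A → F) (p : A → Prop) (s : Finset F) :
    ∑ f ∈ s, {a | φ a = f ∧ p a}.ncard = {a | φ a ∈ s ∧ p a}.ncard := by
  classical
  have := Fintype.ofFinite A
  simp only [Set.ncard_eq_toFinset_card', Set.toFinset_ofPred]
  rw [Finset.card_eq_sum_card_fiberwise (f := φ) (t := s) fun a ha => by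
    simp only [Finset.coe_filter, Finset.mem_univ, true_and] at ha
    exact ha.1]
  refine Finset.sum_congr rfl fun f hf => congrArg Finset.card ?_
  ext a
  simp only [Finset.mem_filter, Finset.mem_univ, true_and]
  exact ⟨fun h => ⟨⟨h.1 ▸ hf, h.2⟩, h.1⟩, fun h => ⟨h.2, h.1.2⟩⟩

theorem Orientation.dir_symm_iff (O : G.Orientation) (hs : Disjoint G.solid G.dashed)
    (d : G.graph.Dart) :
    O.dir d.snd d.fst ↔ ¬ G.dashed.Adj d.fst d.snd ∧ ¬ O.dir d.fst d.snd := by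
  have hs' : ∀ u v, G.solid.Adj u v → ¬ G.dashed.Adj u v := fun u v h1 h2 =>
    (SimpleGraph.disjoint_left.1 hs) u v h1 h2
  constructor
  · exact fun h => ⟨hs' _ _ (O.adj_of_dir _ _ h).symm, O.not_dir_of_dir _ _ h⟩
  · rintro ⟨h1, h2⟩
    exact (O.dir_or_dir _ _ (d.adj.resolve_right h1)).resolve_left h2

namespace Loop

variable (ℓ : G.Loop)

theorem dashed_dart_iff (hs : Disjoint G.solid G.dashed) (j : Fin (2 * ℓ.m)) :
    G.dashed.Adj (ℓ.dart j).fst (ℓ.dart j).snd ↔ j ∈ ℓ.dashedSteps := by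
  refine ⟨fun h => ?_, ℓ.adj_dashed j⟩
  by_contra hj
  exact SimpleGraph.disjoint_left.1 hs _ _ (ℓ.adj_solid j hj) h

/-- Summing the Kasteleyn condition over the faces inside a loop. The darts `e j` are those of the
loop that have the inside on their right. -/
theorem odd_of_isKasteleyn [Finite V] {D : PlaneDrawing G.graph} (hD : IsPlanarDicot D)
    {O : G.Orientation} (hO : IsKasteleyn D O)
    (heuler : 2 * (enclosed D ℓ).ncard + 2 * {f : D.Face | ¬ OutsideLoop D ℓ f}.ncard =
      {d : G.graph.Dart | d.edge ∉ ℓ.edges ∧ ¬ OutsideLoop D ℓ (D.rightFace d)}.ncard + 2)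
    (e : Fin (2 * ℓ.m) → G.graph.Dart) (he : Function.Injective e)
    (he' : ∀ d : G.graph.Dart,
      (¬ OutsideLoop D ℓ (D.rightFace d) ∧ d.edge ∈ ℓ.edges) ↔ ∃ j, e j = d)
    (hed : ∀ j, G.dashed.Adj (e j).fst (e j).snd ↔ j ∈ ℓ.dashedSteps) :
    Odd ((enclosed D ℓ).ncard + {j | O.dir (e j).fst (e j).snd}.ncard +
      ℓ.dashedSteps.card / 2) := by
  classical
  have := Fintype.ofFinite D.Face
  let S : D.Face → Prop := fun f => ¬ OutsideLoop D ℓ f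
  replace heuler : 2 * (enclosed D ℓ).ncard + 2 * {f : D.Face | S f}.ncard =
      {d : G.graph.Dart | d.edge ∉ ℓ.edges ∧ S (D.rightFace d)}.ncard + 2 := heuler
  have hSsymm : ∀ d : G.graph.Dart, d.edge ∉ ℓ.edges →
      (S (D.rightFace d) ↔ S (D.rightFace d.symm)) :=
    fun d hd => not_congr (ℓ.reflTransGen_iff_of_edge_not_mem D.outer hd)
  set s : Finset D.Face := Finset.univ.filter S with hs
  have mem_s : ∀ f, f ∈ s ↔ S f := fun f => by simp [hs]
  have hcard : {f : D.Face | S f}.ncard = s.card := by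
    rw [← Set.ncard_coe_finset]
    exact congrArg Set.ncard (Set.ext fun f => (mem_s f).symm)
  -- The Kasteleyn condition may fail at the outer face, which is not in `s`; faces not in `s` get
  -- the dummy values 0.
  have hk : ∀ f, ∃ k h, f ∈ s → dashedCount D f = 2 * h ∧ clockwiseCount D O f + h = 2 * k + 1 := by
    intro f
    by_cases hf : f ∈ s
    · obtain ⟨h, hh⟩ := hD.even_dashedCount f
      have hout : f ≠ D.outer := by
        rintro rfl
        exact (mem_s _).1 hf .refl
      obtain ⟨k, hk⟩ := hO f hout
      exact ⟨k, h, fun _ => ⟨by omega, by rw [← hk]; omega⟩⟩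
    · exact ⟨0, 0, fun h => absurd h hf⟩
  choose k h hkh using hk
  have h1 : ∑ f ∈ s, dashedCount D f = 2 * ∑ f ∈ s, h f := by
    rw [Finset.mul_sum]
    exact Finset.sum_congr rfl fun f hf => (hkh f hf).1
  have h2 : ∑ f ∈ s, clockwiseCount D O f + ∑ f ∈ s, h f = 2 * ∑ f ∈ s, k f + s.card := by
    rw [Finset.mul_sum, ← Finset.sum_add_distrib, Finset.card_eq_sum_ones,
      ← Finset.sum_add_distrib]
    exact Finset.sum_congr rfl fun f hf => (hkh f hf).2
  have hsplit : ∀ p : G.graph.Dart → Prop,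
      {d | D.rightFace d ∈ s ∧ p d}.ncard =
        {j | p (e j)}.ncard + {d | (d.edge ∉ ℓ.edges ∧ S (D.rightFace d)) ∧ p d}.ncard := by
    intro p
    rw [← RotationSystem.ncard_and_add_ncard_and_not _ fun d : G.graph.Dart => d.edge ∈ ℓ.edges]
    congr 1
    · rw [← Set.ncard_image_of_injective _ he]
      congr 1
      ext d
      constructor
      · rintro ⟨⟨h1, h2⟩, h3⟩
        obtain ⟨j, rfl⟩ := (he' d).1 ⟨(mem_s _).1 h1, h3⟩
        exact ⟨j, h2, rfl⟩
      · rintro ⟨j, h1, rfl⟩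
        obtain ⟨h2, h3⟩ := (he' (e j)).2 ⟨j, rfl⟩
        exact ⟨⟨(mem_s _).2 h2, h1⟩, h3⟩
    · congr 1
      ext d
      change (_ ∧ _) ∧ _ ↔ (_ ∧ _) ∧ _
      rw [mem_s]
      tauto
  have hdash := hsplit fun d => G.dashed.Adj d.fst d.snd
  have hdir := hsplit fun d => O.dir d.fst d.snd
  have h3 := sum_ncard_fiber D.rightFace (fun d => G.dashed.Adj d.fst d.snd) s
  have h4 := sum_ncard_fiber D.rightFace (fun d => O.dir d.fst d.snd) s
  change ∑ f ∈ s, dashedCount D f = _ at h3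
  change ∑ f ∈ s, clockwiseCount D O f = _ at h4
  have hloop : {j | G.dashed.Adj (e j).fst (e j).snd}.ncard = ℓ.dashedSteps.card := by
    rw [← Set.ncard_coe_finset]
    exact congrArg Set.ncard (Set.ext hed)
  have h5 := RotationSystem.ncard_and_add_ncard_and_not
    (fun d : G.graph.Dart => d.edge ∉ ℓ.edges ∧ S (D.rightFace d))
    fun d => G.dashed.Adj d.fst d.snd
  have h6 := RotationSystem.ncard_and_add_ncard_and_not
    (fun d : G.graph.Dart => (d.edge ∉ ℓ.edges ∧ S (D.rightFace d)) ∧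
      ¬ G.dashed.Adj d.fst d.snd) fun d => O.dir d.fst d.snd
  have h7 : {d : G.graph.Dart | ((d.edge ∉ ℓ.edges ∧ S (D.rightFace d)) ∧
      ¬ G.dashed.Adj d.fst d.snd) ∧ O.dir d.fst d.snd} =
      {d : G.graph.Dart | (d.edge ∉ ℓ.edges ∧ S (D.rightFace d)) ∧ O.dir d.fst d.snd} := by
    ext d
    refine and_congr_left fun h => and_iff_left ?_
    exact SimpleGraph.disjoint_left.1 hD.simple _ _ (O.adj_of_dir _ _ h)
  -- Reversal keeps a dart off the loop inside and exchanges solid darts along and against the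
  -- orientation.
  have h8 : {d : G.graph.Dart | ((d.edge ∉ ℓ.edges ∧ S (D.rightFace d)) ∧
      ¬ G.dashed.Adj d.fst d.snd) ∧ ¬ O.dir d.fst d.snd}.ncard =
      {d : G.graph.Dart |
        (d.edge ∉ ℓ.edges ∧ S (D.rightFace d)) ∧ O.dir d.fst d.snd}.ncard := by
    rw [← Set.ncard_image_of_injective _ SimpleGraph.Dart.symm_involutive.injective]
    congr 1
    ext d
    rw [SimpleGraph.Dart.symm_involutive.image_eq_preimage_symm]
    change ((d.symm.edge ∉ _ ∧ S _) ∧ _) ∧ _ ↔ (_ ∧ _) ∧ _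
    have h := O.dir_symm_iff hD.simple d.symm
    change O.dir d.fst d.snd ↔ _ at h
    rw [h, SimpleGraph.Dart.edge_symm, and_assoc]
    exact and_congr_left fun _ => and_congr_right fun hd => (hSsymm d hd).symm
  rw [h7, h8] at h6
  beta_reduce at h3 h4 h5 h6 hdash hdir
  obtain ⟨c, hc⟩ := ℓ.even_dashed
  rw [Nat.odd_iff]
  omega

theorem ncard_solid_steps_add_card (p : Fin (2 * ℓ.m) → Prop) :
    {j | j ∉ ℓ.dashedSteps ∧ p j}.ncard + {j | j ∉ ℓ.dashedSteps ∧ ¬ p j}.ncard +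
      ℓ.dashedSteps.card = 2 * ℓ.m := by
  rw [RotationSystem.ncard_and_add_ncard_and_not, ← Set.ncard_coe_finset, add_comm]
  exact (Set.ncard_add_ncard_compl _).trans (Nat.card_fin _)

theorem setOf_dir_dart (hs : Disjoint G.solid G.dashed) (O : G.Orientation) :
    {j | O.dir (ℓ.dart j).fst (ℓ.dart j).snd} =
      {j | j ∉ ℓ.dashedSteps ∧ O.dir (ℓ.dart j).fst (ℓ.dart j).snd} := by
  ext j
  refine (and_iff_right_of_imp fun h => ?_).symm
  rw [← ℓ.dashed_dart_iff hs]
  exact SimpleGraph.disjoint_left.1 hs _ _ (O.adj_of_dir _ _ h)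

theorem setOf_dir_symm_dart (hs : Disjoint G.solid G.dashed) (O : G.Orientation) :
    {j | O.dir (ℓ.dart j).symm.fst (ℓ.dart j).symm.snd} =
      {j | j ∉ ℓ.dashedSteps ∧ ¬ O.dir (ℓ.dart j).fst (ℓ.dart j).snd} := by
  ext j
  rw [Set.mem_ofPred_eq, Set.mem_ofPred_eq, ← ℓ.dashed_dart_iff hs]
  exact O.dir_symm_iff hs (ℓ.dart j)

/-- With the inside on the right, the Kasteleyn sum counts solid steps along the orientation instead
of against it. The parity is the same, because the number of solid steps is even. -/
theorem odd_enclosed_add_of_ne_one [Finite V] {D : PlaneDrawing G.graph} (hD : IsPlanarDicot D)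
    {O : G.Orientation} (hO : IsKasteleyn D O) (hm : ℓ.m ≠ 1) :
    Odd ((enclosed D ℓ).ncard +
      {j | j ∉ ℓ.dashedSteps ∧ ¬ O.dir (ℓ.dart j).fst (ℓ.dart j).snd}.ncard +
      ℓ.dashedSteps.card / 2) := by
  obtain ⟨hsides, heuler⟩ := ℓ.jordan_euler D hm
  rcases hsides with hside | hside
  · have h := ℓ.odd_of_isKasteleyn hD hO heuler ℓ.dart ℓ.dart_injective (fun d => ?_)
      (ℓ.dashed_dart_iff hD.simple)
    · rw [ℓ.setOf_dir_dart hD.simple] at h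
      have h1 := ℓ.ncard_solid_steps_add_card fun j => O.dir (ℓ.dart j).fst (ℓ.dart j).snd
      obtain ⟨c, hc⟩ := ℓ.even_dashed
      rw [Nat.odd_iff] at h ⊢
      omega
    · constructor
      · rintro ⟨h1, h2⟩
        obtain ⟨j, rfl | rfl⟩ := (ℓ.edge_mem_edges_iff d).1 h2
        exacts [⟨j, rfl⟩, absurd (hside j).2 h1]
      · rintro ⟨j, rfl⟩
        exact ⟨(hside j).1, ℓ.edge_dart_mem j⟩
  · have h := ℓ.odd_of_isKasteleyn hD hO heuler (fun j => (ℓ.dart j).symm)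
      ℓ.symm_dart_injective (fun d => ?_)
      (fun j => (G.dashed.adj_comm _ _).trans (ℓ.dashed_dart_iff hD.simple j))
    · rwa [ℓ.setOf_dir_symm_dart hD.simple] at h
    · constructor
      · rintro ⟨h1, h2⟩
        obtain ⟨j, rfl | rfl⟩ := (ℓ.edge_mem_edges_iff d).1 h2
        exacts [absurd (hside j).1 h1, ⟨j, rfl⟩]
      · rintro ⟨j, rfl⟩
        refine ⟨(hside j).2, ?_⟩
        rw [SimpleGraph.Dart.edge_symm]
        exact ℓ.edge_dart_mem j

/-! ### Doubled edges, and the sign of the weight. -/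

theorem symm_dart_of_eq_one (hm : ℓ.m = 1) (j : Fin (2 * ℓ.m)) :
    (ℓ.dart j).symm = ℓ.dart (finRotate _ j) := by
  have h : ∀ n, n = 2 → ∀ j : Fin n, finRotate n (finRotate n j) = j := by
    rintro _ rfl
    decide
  ext
  · rfl
  · exact congrArg ℓ.vert (h _ (by omega) j).symm

/-- The reverse of one dart of a doubled edge is its other dart, so the two sides of the loop
coincide. -/
theorem outsideLoop_of_eq_one [Finite V] (D : PlaneDrawing G.graph) (hm : ℓ.m = 1)
    (f : D.Face) : OutsideLoop D ℓ f := by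
  have j : Fin (2 * ℓ.m) := ⟨0, by omega⟩
  have hT : ∀ d : G.graph.Dart, d.edge ∉ ℓ.edges →
      (OutsideLoop D ℓ (D.rightFace d) ↔ OutsideLoop D ℓ (D.rightFace d.symm)) :=
    fun d hd => ℓ.reflTransGen_iff_of_edge_not_mem D.outer hd
  have h := ℓ.rightFace_dart_iff D _ hT j (finRotate _ j)
  have key : ∀ g, OutsideLoop D ℓ g ↔ OutsideLoop D ℓ (D.rightFace (ℓ.dart j)) := by
    intro g
    rcases ℓ.reflTransGen_right_or_left D j g with hg | hg
    · exact (ℓ.iff_of_reflTransGen hT hg).symm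
    · rw [ℓ.symm_dart_of_eq_one hm] at hg
      exact (ℓ.iff_of_reflTransGen hT hg).symm.trans h.symm
  exact (key f).2 ((key D.outer).1 .refl)

theorem odd_enclosed_add [Finite V] {D : PlaneDrawing G.graph} (hD : IsPlanarDicot D)
    {O : G.Orientation} (hO : IsKasteleyn D O) :
    Odd ((enclosed D ℓ).ncard +
      {j | j ∉ ℓ.dashedSteps ∧ ¬ O.dir (ℓ.dart j).fst (ℓ.dart j).snd}.ncard +
      ℓ.dashedSteps.card / 2) := by
  by_cases hm : ℓ.m = 1
  · have h1 : (enclosed D ℓ).ncard = 0 := by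
      rw [Set.ncard_eq_zero, Set.eq_empty_iff_forall_notMem]
      rintro v ⟨-, hv⟩
      obtain ⟨d, hd⟩ := exists_dart_fst_eq ℓ D v
      exact hv d hd (ℓ.outsideLoop_of_eq_one D hm _)
    have h2 := ℓ.ncard_solid_steps_add_card fun j => O.dir (ℓ.dart j).fst (ℓ.dart j).snd
    rw [← ℓ.setOf_dir_dart hD.simple, ← ℓ.setOf_dir_symm_dart hD.simple] at h2
    rw [← ℓ.setOf_dir_symm_dart hD.simple]
    -- Rotating the index exchanges the two steps, so as many go along the orientation as against
    -- it.
    have h3 : {j | O.dir (ℓ.dart j).symm.fst (ℓ.dart j).symm.snd}.ncard =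
        {j | O.dir (ℓ.dart j).fst (ℓ.dart j).snd}.ncard := by
      rw [← Set.ncard_image_of_injective _ (finRotate (2 * ℓ.m)).injective,
        Equiv.image_eq_preimage_symm]
      congr 1
      ext j
      rw [Set.mem_preimage, Set.mem_ofPred_eq, Set.mem_ofPred_eq, ℓ.symm_dart_of_eq_one hm,
        Equiv.apply_symm_apply]
    obtain ⟨c, hc⟩ := ℓ.even_dashed
    rw [Nat.odd_iff]
    omega
  · exact ℓ.odd_enclosed_add_of_ne_one hD hO hm

theorem edgeProduct_pos (w : G.Weights) : 0 < ℓ.edgeProduct w := by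
  refine Finset.prod_pos fun j _ => ?_
  split_ifs with h
  · exact w.b_pos _ _ (ℓ.adj_dashed j h)
  · exact w.a_pos _ _ (ℓ.adj_solid j h)

/-- The `+ 1` in the exponent is the minus sign in the definition of `weight`. -/
theorem weight_eq (w : G.Weights) (O : G.Orientation) :
    ℓ.weight w O = (-1 : ℂ) ^
      ({j | j ∉ ℓ.dashedSteps ∧ ¬ O.dir (ℓ.dart j).fst (ℓ.dart j).snd}.ncard +
        ℓ.dashedSteps.card / 2 + 1) * (ℓ.edgeProduct w : ℂ) := by
  classical
  have h1 : ∀ j, (if j ∈ ℓ.dashedSteps then Complex.I * (w.b (ℓ.vert j) (ℓ.next j) : ℂ)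
      else if O.dir (ℓ.vert j) (ℓ.next j) then (w.a (ℓ.vert j) (ℓ.next j) : ℂ)
      else - (w.a (ℓ.vert j) (ℓ.next j) : ℂ)) =
      (if j ∈ ℓ.dashedSteps then Complex.I else 1) *
      (if j ∉ ℓ.dashedSteps ∧ ¬ O.dir (ℓ.dart j).fst (ℓ.dart j).snd then -1 else 1) *
      (((if j ∈ ℓ.dashedSteps then w.b (ℓ.vert j) (ℓ.next j)
        else w.a (ℓ.vert j) (ℓ.next j) : ℝ)) : ℂ) := by
    intro j
    change _ = _ * (if _ ∧ ¬ O.dir (ℓ.vert j) (ℓ.next j) then _ else _) * _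
    by_cases hj : j ∈ ℓ.dashedSteps
    · simp [hj]
    · by_cases hd : O.dir (ℓ.vert j) (ℓ.next j) <;> simp [hj, hd]
  obtain ⟨c, hc⟩ := ℓ.even_dashed
  have h2 : Complex.I ^ ℓ.dashedSteps.card = (-1) ^ (ℓ.dashedSteps.card / 2) := by
    rw [hc, ← two_mul, pow_mul, Complex.I_sq, Nat.mul_div_cancel_left _ two_pos]
  have h3 : {j | j ∉ ℓ.dashedSteps ∧ ¬ O.dir (ℓ.dart j).fst (ℓ.dart j).snd}.ncard =
      (Finset.univ.filter fun j =>
        j ∉ ℓ.dashedSteps ∧ ¬ O.dir (ℓ.dart j).fst (ℓ.dart j).snd).card := by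
    rw [← Set.ncard_coe_finset]
    congr 1
    ext j
    simp
  rw [weight, edgeProduct, Complex.ofReal_prod, Finset.prod_congr rfl fun j _ => h1 j,
    Finset.prod_mul_distrib, Finset.prod_mul_distrib, Finset.prod_ite, Finset.prod_ite, h3]
  simp only [Finset.prod_const, Finset.filter_univ_mem]
  rw [h2]
  ring

end Loop

end Dicot

theorem mainTheorem7 {V : Type*} [Finite V] (G : Dicot V) (w : G.Weights)
    (D : PlaneDrawing G.graph) (hD : Dicot.IsPlanarDicot D)
    (O : G.Orientation) (hO : Dicot.IsKasteleyn D O) (ℓ : G.Loop) :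
    ℓ.weight w O = (-1 : ℂ) ^ (Dicot.enclosed D ℓ).ncard * (ℓ.edgeProduct w : ℂ) ∧
      0 < ℓ.edgeProduct w := by
  refine ⟨?_, ℓ.edgeProduct_pos w⟩
  obtain ⟨k, hk⟩ := ℓ.odd_enclosed_add hD hO
  rw [ℓ.weight_eq]
  congr 1
  rw [neg_one_pow_congr]
  rw [Nat.even_iff, Nat.even_iff]
  omega
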